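/- \textbf{Setting.} Let $(M,g)$ be a four-dimensional time-oriented smooth manifold with a smooth Lorentzian metric $g$ of signature $(-,+,+,+)$ and a smooth linear connection $\nabla$ preserving $g$ (possibly with torsion). Let $S(0)\subset M$ be a connected embedded smooth spacelike hypersurface, $D\subseteq S(0)$ an open domain, and let $m=\Phi(x,t)$ be a Gaussian chart over $D$: $\Phi$ is a diffeomorphism of $D\times\mathbb R$ onto an open region $\Omega\subseteq M$, $\Phi(x,0)=x$, and the curves $t\mapsto\Phi(x,t)$ are the integral curves of a smooth vector field $n$ on $\Omega$ which on $D$ is the future-oriented normal of $S(0)$ with $g(n,n)=-1$ and which satisfies $\nabla_n n=0$ (the curves are geodesics). The variables form a complex vector space $E$ of sections over $\Omega$ of a complex vector bundle trivialized over $\Omega$. An observer whose time coordinate is translated by $\theta\in\mathbb R$ uses the chart $(x,t)\mapsto\Phi(x,t-\theta)$; reporting the components he reads in the chart of the reference observer ($\theta=0$) gives the gauge transformation $(U(\theta)X)(x,t)=X(x,t-\theta)$. All these observers use the same model: (a) $U(\theta)E\subseteq E$ for all $\theta$; (b) there are a complex Hilbert space $H$ and an injective linear map $\Upsilon:E\to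 H$ with dense range; $E$ carries the inner product (positive kernel) $K(X,Y)=\langle\Upsilon X,\Upsilon Y\rangle_H$; (c) there is a set $H_0\subseteq H$ of states, and to each state $\psi\in H_0$ the observer $\theta$ assigns a measure $X_\theta(\psi)\in E$, with $X_\theta(\psi)=U(\theta)X_0(\psi)$ and $K(X_\theta(\psi_1),X_\theta(\psi_2))=\langle\psi_1,\psi_2\rangle_H$ for every $\theta\in\mathbb R$ and all $\psi_1,\psi_2\in H_0$; the vectors $X_0(\psi)$, $\psi\in H_0$, span $E$; (d) for every $X\in E$, $U(\theta)X\to X$ as $\theta\to0$ in the norm defined by $K$. The evolution of the system with variables $X\in E$ is the map $\psi:\mathbb R\to H$, $\psi(t)=\Upsilon(U(t)X)$. \textbf{Proposition 22 (translation in time, General Relativity).} Let $\hbar>0$ be any fixed constant, the same for all systems. There are unitary operators $\widehat U(\theta)$ on $H$, $\theta\in\mathbb R$, with $\widehat U(\theta)\circ\Upsilon=\Upsilon\circ U(\theta)$, which form a strongly continuous one-parameter group ($\widehat U(0)=\mathrm{Id}$, $\widehat U(\theta+\theta')=\widehat U(\theta)\widehat U(\theta')$), and there is a (possibly unbounded)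 self-adjoint operator $\mathcal H$ on $H$ such that $$\widehat U(t)=\exp\Big(\frac{t}{i\hbar}\mathcal H\Big)\quad(t\in\mathbb R),$$ and the evolution of the system with any variables $X\in E$ is $\psi(t)=\widehat U(t)\psi(0)$. Moreover the Schr\"odinger equation holds: if $\psi_0$ is in the domain of $\mathcal H$ and $\psi(t)=\widehat U(t)\psi_0$, then for every $t$ the vector $\psi(t)$ is in the domain of $\mathcal H$, $\psi$ is differentiable at $t$, and $i\hbar\,\frac{d\psi}{dt}(t)=\mathcal H\psi(t)$. Here, for a self-adjoint $\mathcal H$ and $z\in i\mathbb R$, $\exp(z\mathcal H)\psi=\lim_{k\to\infty}\exp(z\mathcal H_k)\psi$ with the bounded operators $\mathcal H_k=k^2\mathcal H(\mathcal H^2+k^2)^{-1}$, $k=1,2,\dots$ (this agrees with the exponential defined by the spectral theorem). -/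

import Mathlib

open Bundle Filter Topology
open scoped Manifold ContDiff InnerProductSpace

noncomputable section

namespace TimeTranslation

/-! ## Exponential of an unbounded operator -/

section Exponential

variable {H : Type*} [NormedAddCommGroup H] [InnerProductSpace ℂ H]

/-- `R` is the bounded, everywhere defined inverse of `A - z`. -/
def IsResolvent (A : H →ₗ.[ℂ] H) (z : ℂ) (R : H →L[ℂ] H) : Prop :=
  (∀ x : H, ∃ h : R x ∈ A.domain, A ⟨R x, h⟩ - z • R x = x) ∧
    ∀ y : A.domain, R (A y - z • (y : H)) = y

/-- The bounded truncation `k² A (A² + k²)⁻¹ = (k²/2) ((A - ik)⁻¹ + (A + ik)⁻¹)` of `A`, written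
through the resolvents `R = (A - ik)⁻¹` and `R' = (A + ik)⁻¹`. -/
def truncation (k : ℂ) (R R' : H →L[ℂ] H) : H →L[ℂ] H :=
  (k ^ 2 / 2) • (R + R')

/-- `T = exp (z A)` for an operator `A` that need not be bounded: `T ψ` is the limit, as `k → ∞`, of
`exp (z Aₖ) ψ`, where `Aₖ = k² A (A² + k²)⁻¹` are the bounded truncations of `A` (`Aₖ ψ → A ψ` on
the domain of a self-adjoint `A`) and the exponential of a bounded operator is the sum of its
power series. -/
def IsExp (A : H →ₗ.[ℂ] H) (z : ℂ) (T : H →L[ℂ] H) : Prop :=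
  ∃ R R' : ℕ → H →L[ℂ] H,
    (∀ n : ℕ, IsResolvent A (Complex.I * (n + 1)) (R n)) ∧
    (∀ n : ℕ, IsResolvent A (-(Complex.I * (n + 1))) (R' n)) ∧
    ∀ ψ : H, Tendsto
      (fun n : ℕ => NormedSpace.exp (z • truncation ((n : ℂ) + 1) (R n) (R' n)) ψ)
      atTop (𝓝 (T ψ))

end Exponential

/-! ## Spacetime and Gaussian charts -/

section Geometry

/-- The geometry of the universe: a Lorentzian metric of signature `(-,+,+,+)` on a four dimensional
manifold, a time orientation, and a linear connection that preserves the metric (its torsion is not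
required to vanish, the Levi-Civita connection being the torsion free case). -/
structure Spacetime (M : Type*) [TopologicalSpace M]
    [ChartedSpace (EuclideanSpace ℝ (Fin 4)) M] [IsManifold (𝓡 4) ∞ M] where
  /-- the metric tensor -/
  metric : ∀ m : M, TangentSpace (𝓡 4) m →L[ℝ] TangentSpace (𝓡 4) m →L[ℝ] ℝ
  metric_symm : ∀ (m : M) (u v : TangentSpace (𝓡 4) m), metric m u v = metric m v u
  metric_smooth :
    ContMDiff (𝓡 4)
      ((𝓡 4).prod 𝓘(ℝ, EuclideanSpace ℝ (Fin 4) →L[ℝ] EuclideanSpace ℝ (Fin 4) →L[ℝ] ℝ)) ∞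
      (fun m : M => TotalSpace.mk'
        (EuclideanSpace ℝ (Fin 4) →L[ℝ] EuclideanSpace ℝ (Fin 4) →L[ℝ] ℝ)
        (E := fun m : M => TangentSpace (𝓡 4) m →L[ℝ] TangentSpace (𝓡 4) m →L[ℝ] ℝ)
        m (metric m))
  metric_signature : ∀ m : M, ∃ b : Module.Basis (Fin 4) ℝ (TangentSpace (𝓡 4) m),
    ∀ i j, metric m (b i) (b j) = if i = j then (if i = 0 then -1 else 1) else 0
  /-- a continuous timelike vector field that gives the time orientation -/
  timeDirection : ∀ m : M, TangentSpace (𝓡 4) m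
  timeDirection_continuous :
    Continuous (fun m : M => (⟨m, timeDirection m⟩ : TangentBundle (𝓡 4) M))
  timeDirection_timelike : ∀ m : M, metric m (timeDirection m) (timeDirection m) < 0
  /-- the linear connection: `connection X m v` is `∇_v X` at `m` -/
  connection : CovariantDerivative (𝓡 4) (EuclideanSpace ℝ (Fin 4))
    (fun m : M => TangentSpace (𝓡 4) m)
  connection_smooth : CovariantDerivative.ContMDiffCovariantDerivative connection ∞
  connection_metric : ∀ (m : M) (v : TangentSpace (𝓡 4) m)
    (X Y : ∀ p : M, TangentSpace (𝓡 4) p),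
    MDifferentiableAt (𝓡 4) (𝓡 4).tangent
      (fun p => (⟨p, X p⟩ : TangentBundle (𝓡 4) M)) m →
    MDifferentiableAt (𝓡 4) (𝓡 4).tangent
      (fun p => (⟨p, Y p⟩ : TangentBundle (𝓡 4) M)) m →
    mfderiv (𝓡 4) 𝓘(ℝ, ℝ) (fun p : M => metric p (X p) (Y p)) m v =
      metric m (connection X m v) (Y m) + metric m (X m) (connection Y m v)

variable {M : Type*} [TopologicalSpace M]
  [ChartedSpace (EuclideanSpace ℝ (Fin 4)) M] [IsManifold (𝓡 4) ∞ M]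

/-- A vector is future oriented if it is timelike and in the same half of the light cone as the
time direction. -/
def Spacetime.IsFutureOriented (U : Spacetime M) (m : M) (v : TangentSpace (𝓡 4) m) : Prop :=
  U.metric m v v < 0 ∧ U.metric m v (U.timeDirection m) < 0

/-- A connected spacelike hypersurface `S(0)`: a connected three dimensional manifold `S` embedded
in the universe, on which the metric induces a Riemannian (positive definite) metric. -/
structure SpacelikeHypersurface (U : Spacetime M) (S : Type*) [TopologicalSpace S]
    [ChartedSpace (EuclideanSpace ℝ (Fin 3)) S] [IsManifold (𝓡 3) ∞ S] where
  /-- the inclusion of the hypersurface -/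
  incl : S → M
  embedding : Manifold.IsSmoothEmbedding (𝓡 3) (𝓡 4) ∞ incl
  connected : ConnectedSpace S
  spacelike : ∀ (x : S) (v : TangentSpace (𝓡 3) x), v ≠ 0 →
    0 < U.metric (incl x) (mfderiv (𝓡 3) (𝓡 4) incl x v) (mfderiv (𝓡 3) (𝓡 4) incl x v)

/-- The Gaussian chart `m = Φ(x, t)` of the region swept by the geodesics that start from an open
domain of the hypersurface `S(0)` along its future oriented unit normal `n`. -/
structure GaussianChart {U : Spacetime M} {S : Type*} [TopologicalSpace S]
    [ChartedSpace (EuclideanSpace ℝ (Fin 3)) S] [IsManifold (𝓡 3) ∞ S]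
    (S₀ : SpacelikeHypersurface U S) where
  /-- the open domain of `S(0)` that defines the system -/
  domain : TopologicalSpace.Opens S
  /-- the map `Φ`, a diffeomorphism from `domain × ℝ` onto the region `Ω` occupied by the system -/
  chart : OpenPartialHomeomorph (S × ℝ) M
  source_eq : chart.source = (domain : Set S) ×ˢ Set.univ
  smooth : ContMDiffOn ((𝓡 3).prod 𝓘(ℝ, ℝ)) (𝓡 4) ∞ chart chart.source
  smooth_symm : ContMDiffOn (𝓡 4) ((𝓡 3).prod 𝓘(ℝ, ℝ)) ∞ chart.symm chart.target
  /-- the vector field `n` (only its values on the region `Ω` matter) -/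
  normal : ∀ m : M, TangentSpace (𝓡 4) m
  normal_smooth : ContMDiffOn (𝓡 4) (𝓡 4).tangent ∞
    (fun m => (⟨m, normal m⟩ : TangentBundle (𝓡 4) M)) chart.target
  /-- on `S(0)` the field `n` is normal to `S(0)`, of norm `-1` and future oriented -/
  normal_orthogonal : ∀ x ∈ domain, ∀ v : TangentSpace (𝓡 3) x,
    U.metric (S₀.incl x) (normal (S₀.incl x)) (mfderiv (𝓡 3) (𝓡 4) S₀.incl x v) = 0
  normal_unit : ∀ x ∈ domain,
    U.metric (S₀.incl x) (normal (S₀.incl x)) (normal (S₀.incl x)) = -1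
  normal_future : ∀ x ∈ domain, U.IsFutureOriented (S₀.incl x) (normal (S₀.incl x))
  /-- the integral curves of `n` are geodesics -/
  geodesic : ∀ m ∈ chart.target, U.connection normal m (normal m) = 0
  /-- `Φ` is the flow of `n` from `S(0)` -/
  chart_zero : ∀ x ∈ domain, chart (x, 0) = S₀.incl x
  chart_flow : ∀ x ∈ domain, IsMIntegralCurve (fun t : ℝ => chart (x, t)) normal

variable {U : Spacetime M} {S : Type*} [TopologicalSpace S]
  [ChartedSpace (EuclideanSpace ℝ (Fin 3)) S] [IsManifold (𝓡 3) ∞ S]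
  {S₀ : SpacelikeHypersurface U S}

/-- The region `Ω` of the universe occupied by the system. -/
def GaussianChart.region (G : GaussianChart S₀) : Set M := G.chart.target

/-- The chart used by the observer whose time coordinate is translated by `θ`: the event that this
observer labels `(x, t)` is `Φ(x, t - θ)`. -/
def GaussianChart.event (G : GaussianChart S₀) (θ : ℝ) (x : G.domain) (t : ℝ) : G.region :=
  ⟨G.chart ((x : S), t - θ), G.chart.map_source (by rw [G.source_eq]; exact ⟨x.2, trivial⟩)⟩

/-- The spatial label `x` of an event `m = Φ(x, t)`. -/
def GaussianChart.place (G : GaussianChart S₀) (m : G.region) : G.domain :=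
  ⟨(G.chart.symm (m : M)).1, by
    have h := G.chart.map_target m.2
    rw [G.source_eq] at h
    exact h.1⟩

/-- The time label `t` of an event `m = Φ(x, t)` for the reference observer. -/
def GaussianChart.time (G : GaussianChart S₀) (m : G.region) : ℝ :=
  (G.chart.symm (m : M)).2

theorem GaussianChart.event_place_time (G : GaussianChart S₀) (m : G.region) :
    G.event 0 (G.place m) (G.time m) = m := by
  apply Subtype.ext
  simp only [event, place, time, sub_zero]
  exact G.chart.right_inv m.2

theorem GaussianChart.place_event (G : GaussianChart S₀) (θ : ℝ) (x : G.domain) (t : ℝ) :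
    G.place (G.event θ x t) = x := by
  apply Subtype.ext
  simp only [event, place]
  rw [G.chart.left_inv (by rw [G.source_eq]; exact ⟨x.2, trivial⟩)]

theorem GaussianChart.time_event (G : GaussianChart S₀) (θ : ℝ) (x : G.domain) (t : ℝ) :
    G.time (G.event θ x t) = t - θ := by
  simp only [event, time]
  rw [G.chart.left_inv (by rw [G.source_eq]; exact ⟨x.2, trivial⟩)]

end Geometry

/-! ## Variables, observers and states -/

section Model

variable {M : Type*} [TopologicalSpace M]
  [ChartedSpace (EuclideanSpace ℝ (Fin 4)) M] [IsManifold (𝓡 4) ∞ M]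
  {U : Spacetime M} {S : Type*} [TopologicalSpace S]
  [ChartedSpace (EuclideanSpace ℝ (Fin 3)) S] [IsManifold (𝓡 3) ∞ S]
  {S₀ : SpacelikeHypersurface U S}
  {V : Type*} [NormedAddCommGroup V] [NormedSpace ℂ V]
  {F : M → Type*} [TopologicalSpace (TotalSpace V F)]
  [∀ m, AddCommGroup (F m)] [∀ m, Module ℂ (F m)]
  [∀ m, TopologicalSpace (F m)]

/-- The components, in the trivialization `e`, that the observer translated by `θ` reads at the
point that he labels `(x, t)` for a section `X` over the region of the system. -/
def reading (G : GaussianChart S₀) (e : Trivialization V (π V F)) [e.IsLinear ℂ]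
    (he : G.region ⊆ e.baseSet) (θ : ℝ) (X : ∀ m : G.region, F m) (x : G.domain) (t : ℝ) : V :=
  e.linearEquivAt ℂ (G.event θ x t : M) (he (G.event θ x t).2) (X (G.event θ x t))

/-- The gauge transformation `U(θ)` induced on sections by a translation of time by `θ`: the
components of `U(θ) X` are `(x, t) ↦ X(x, t - θ)`. -/
def translate (G : GaussianChart S₀) (e : Trivialization V (π V F)) [e.IsLinear ℂ]
    (he : G.region ⊆ e.baseSet) (θ : ℝ) :
    (∀ m : G.region, F m) →ₗ[ℂ] (∀ m : G.region, F m) :=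
  LinearMap.pi fun m =>
    (e.linearEquivAt ℂ (m : M) (he m.2)).symm.toLinearMap ∘ₗ
      (e.linearEquivAt ℂ (G.event θ (G.place m) (G.time m) : M)
        (he (G.event θ (G.place m) (G.time m)).2)).toLinearMap ∘ₗ
      LinearMap.proj (G.event θ (G.place m) (G.time m))

/-- `U(θ) X` is the section that has, for the reference observer, the components of `X` read by the
observer translated by `θ`. -/
theorem reading_translate (G : GaussianChart S₀) (e : Trivialization V (π V F)) [e.IsLinear ℂ]
    (he : G.region ⊆ e.baseSet) (θ : ℝ) (X : ∀ m : G.region, F m) (x : G.domain) (t : ℝ) :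
    reading G e he 0 (translate G e he θ X) x t = reading G e he θ X x t := by
  have h1 : G.place (G.event 0 x t) = x := G.place_event 0 x t
  have h2 : G.time (G.event 0 x t) = t := by rw [G.time_event, sub_zero]
  have h3 : reading G e he 0 (translate G e he θ X) x t =
      reading G e he θ X (G.place (G.event 0 x t)) (G.time (G.event 0 x t)) := by
    simp only [reading, translate, LinearMap.pi_apply, LinearMap.comp_apply, LinearMap.proj_apply,
      LinearEquiv.coe_coe, LinearEquiv.apply_symm_apply]
  rw [h3, h1, h2]

/-- A model of the system whose variables are sections, over the region `Ω`, of a complex vector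
bundle trivialized over `Ω`, together with its Hilbert space `H` and with the measures done by all
the observers that differ from the reference observer by a translation of time. -/
structure Model (G : GaussianChart S₀) (e : Trivialization V (π V F)) [e.IsLinear ℂ]
    (he : G.region ⊆ e.baseSet) (H : Type*) [NormedAddCommGroup H] [InnerProductSpace ℂ H] where
  /-- the vector space of the sections that the variables can be -/
  sectionSpace : Submodule ℂ (∀ m : G.region, F m)
  /-- all the observers use the same space of variables -/
  translate_mem : ∀ (θ : ℝ), ∀ X ∈ sectionSpace, translate G e he θ X ∈ sectionSpace
  /-- the linear chart, which represents each value of the variables by a vector of `H`. Its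
  positive definite kernel `K(X, Y) = ⟪Υ X, Υ Y⟫` is the inner product of the space of variables,
  for which `Υ` is an isometry, and `H` is the completion of that space. -/
  linearChart : sectionSpace →ₗ[ℂ] H
  linearChart_injective : Function.Injective linearChart
  linearChart_dense : DenseRange linearChart
  /-- the set of the states of the system -/
  states : Set H
  /-- the value of the variables measured by the observer translated by `θ`, expressed in the chart
  of the reference observer, when the system is in a given state -/
  measure : ℝ → states → sectionSpace
  /-- every observer uses a chart of the same model, that is with the same positive kernel -/
  measure_kernel : ∀ (θ : ℝ) (ψ₁ ψ₂ : states),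
    ⟪linearChart (measure θ ψ₁), linearChart (measure θ ψ₂)⟫_ℂ = ⟪(ψ₁ : H), (ψ₂ : H)⟫_ℂ
  /-- the measures of two observers are related by the gauge transformation -/
  measure_gauge : ∀ (θ : ℝ) (ψ : states),
    (measure θ ψ : ∀ m : G.region, F m) = translate G e he θ (measure 0 ψ)
  /-- the values of the variables that can be measured generate the space of variables -/
  measure_span : Submodule.span ℂ (Set.range (measure 0)) = ⊤
  /-- the translations are continuous for the norm of the space of variables -/
  translate_continuous : ∀ X : sectionSpace,
    Tendsto (fun θ : ℝ => linearChart ⟨translate G e he θ X, translate_mem θ X X.2⟩) (𝓝 0)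
      (𝓝 (linearChart X))

variable {G : GaussianChart S₀} {e : Trivialization V (π V F)} [e.IsLinear ℂ]
  {he : G.region ⊆ e.baseSet} {H : Type*} [NormedAddCommGroup H] [InnerProductSpace ℂ H]

/-- The evolution `ψ : ℝ → H` of the system whose variables have the value `X`: `ψ(t)` is the vector
that represents the value `U(t) X` of the variables for the observer translated by `t`. -/
def Model.evolution (P : Model G e he H) (X : P.sectionSpace) (t : ℝ) : H :=
  P.linearChart ⟨translate G e he t X, P.translate_mem t X X.2⟩

end Model

end TimeTranslation

end

/-! Every observer finds the same kernel on the measured vectors, and these span the space of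
variables, so by sesquilinearity each translation preserves the kernel (`Model.inner_translation`).
Translations therefore act as isometric bijections on a dense subspace of `H` and extend to
unitaries; the group law and continuity at `0` survive by density. The rest is Stone's theorem,
reached by a Hille–Yosida argument without spectral theory. Let `A` be the derivative of the group
`U_t` at `0`. The Laplace transform `∫₀^∞ e^{-μt} U_t x dt` inverts `μ - A`, and the time-reversed
group gives the inverse of `μ + A` (`generates_resolvent`, `Generates.resolvent_eq`). Hence `iħA` is
symmetric with `iħA ± ik` bijective, which forces self-adjointness. For the exponential, the
truncations of `iħA` are `iħB`, with `B = μ²A(μ² - A²)⁻¹` and `μ = k/ħ`. Each `B` is bounded,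
skew-adjoint and commutes with the group, and `Bψ → Aψ` on the domain. A Duhamel estimate
(`Generates.norm_exp_boundedGenerator_sub_le`) then gives `exp(tB) → U_t` strongly. -/

theorem exp_mem_unitary_of_star_eq_neg {A : Type*} [NormedRing A] [NormedAlgebra ℂ A]
    [CompleteSpace A] [StarRing A] [ContinuousStar A] {b : A} (h : star b = -b) :
    NormedSpace.exp b ∈ unitary A := by
  let : NormedAlgebra ℚ A := NormedAlgebra.restrictScalars ℚ ℂ A
  exact NormedSpace.exp_mem_unitary_of_mem_skewAdjoint (skewAdjoint.mem_iff.2 h)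

/-- A strongly continuous one-parameter group of unitary operators. -/
structure UnitaryGroup (H : Type*) [NormedAddCommGroup H] [InnerProductSpace ℂ H] where
  /-- the unitary operator at a given time -/
  op : ℝ → H ≃ₗᵢ[ℂ] H
  op_add : ∀ (s t : ℝ) (x : H), op (s + t) x = op s (op t x)
  continuous_op : ∀ x : H, Continuous fun t : ℝ => op t x

/-! ### Generators of one-parameter unitary groups. -/

namespace UnitaryGroup

open MeasureTheory Set

variable {H : Type*} [NormedAddCommGroup H] [InnerProductSpace ℂ H]

theorem op_zero (U : UnitaryGroup H) (x : H) : U.op 0 x = x := by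
  apply (U.op 0).injective
  rw [← U.op_add, add_zero]

/-- The group with time reversed. -/
def reverse (U : UnitaryGroup H) : UnitaryGroup H where
  op t := U.op (-t)
  op_add s t x := by rw [neg_add, U.op_add]
  continuous_op x := (U.continuous_op x).comp continuous_neg

/-- `φ` is the image of `ψ` by the infinitesimal generator of the group. -/
def Generates (U : UnitaryGroup H) (ψ φ : H) : Prop :=
  HasDerivAt (fun t : ℝ => U.op t ψ) φ 0

variable {U : UnitaryGroup H} {ψ φ ψ' φ' : H}

theorem Generates.unique (h : U.Generates ψ φ) (h' : U.Generates ψ φ') : φ = φ' :=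
  HasDerivAt.unique h h'

theorem generates_zero (U : UnitaryGroup H) : U.Generates 0 0 := by
  simpa [Generates] using hasDerivAt_const (0 : ℝ) (0 : H)

theorem Generates.add (h : U.Generates ψ φ) (h' : U.Generates ψ' φ') :
    U.Generates (ψ + ψ') (φ + φ') := by
  simpa [Generates] using HasDerivAt.fun_add h h'

theorem Generates.smul (c : ℂ) (h : U.Generates ψ φ) : U.Generates (c • ψ) (c • φ) := by
  simpa [Generates] using HasDerivAt.fun_const_smul c h

theorem Generates.sub (h : U.Generates ψ φ) (h' : U.Generates ψ' φ') :
    U.Generates (ψ - ψ') (φ - φ') := by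
  simpa [Generates] using HasDerivAt.fun_sub h h'

theorem Generates.hasDerivAt (h : U.Generates ψ φ) (t : ℝ) :
    HasDerivAt (fun s : ℝ => U.op s ψ) (U.op t φ) t := by
  have h1 : HasDerivAt (fun s : ℝ => U.op s ψ) φ (t - t) := by rw [sub_self]; exact h
  have h2 := (h1.comp_sub_const t t)
  have h3 := ((U.op t).toContinuousLinearEquiv.toContinuousLinearMap.restrictScalars
    ℝ).hasFDerivAt.comp_hasDerivAt t h2
  refine h3.congr_of_eventuallyEq (Eventually.of_forall fun s => ?_)
  change U.op s ψ = U.op t (U.op (s - t) ψ)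
  rw [← U.op_add, add_sub_cancel]

theorem Generates.op (h : U.Generates ψ φ) (t : ℝ) : U.Generates (U.op t ψ) (U.op t φ) := by
  have h1 : HasDerivAt (fun s : ℝ => U.op s ψ) (U.op t φ) (0 + t) := by
    rw [zero_add]; exact h.hasDerivAt t
  have h2 := h1.comp_add_const 0 t
  simpa only [Generates, U.op_add] using h2

theorem Generates.reverse (h : U.Generates ψ φ) : U.reverse.Generates ψ (-φ) := by
  have h1 : HasDerivAt (fun s : ℝ => U.op s ψ) φ (-0) := by rw [neg_zero]; exact h
  simpa using! h1.scomp (0 : ℝ) (hasDerivAt_neg (0 : ℝ))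

theorem reverse_reverse (U : UnitaryGroup H) : U.reverse.reverse = U := by
  cases U
  simp [UnitaryGroup.reverse]

/-- The inner product of `U_t ψ` and `U_t ψ'` is constant in `t`; differentiate at `0`. -/
theorem Generates.skew (h : U.Generates ψ φ) (h' : U.Generates ψ' φ') :
    ⟪φ, ψ'⟫_ℂ = -⟪ψ, φ'⟫_ℂ := by
  have h1 := HasDerivAt.inner ℂ h h'
  simp only [LinearIsometryEquiv.inner_map_map, op_zero] at h1
  have h2 := h1.unique (hasDerivAt_const (0 : ℝ) ⟪ψ, ψ'⟫_ℂ)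
  rw [add_comm] at h2
  exact eq_neg_of_add_eq_zero_left h2

/-- The difference `x = ψ - ψ'` satisfies `Ax = μx` with `μ` real, while skewness gives `μ‖x‖² =
-μ‖x‖²`. -/
theorem Generates.resolvent_unique {μ : ℝ} (hμ : 0 < μ) (h : U.Generates ψ φ)
    (h' : U.Generates ψ' φ') (heq : (μ : ℂ) • ψ - φ = (μ : ℂ) • ψ' - φ') : ψ = ψ' := by
  have h1 := h.sub h'
  have h2 : φ - φ' = (μ : ℂ) • (ψ - ψ') := by
    rw [smul_sub, sub_eq_sub_iff_add_eq_add]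
    rw [sub_eq_sub_iff_add_eq_add] at heq
    rw [add_comm φ, heq.symm]
  rw [h2] at h1
  have h3 := h1.skew h1
  rw [inner_smul_left, inner_smul_right, Complex.conj_ofReal, inner_self_eq_norm_sq_to_K] at h3
  have h4 : μ * ‖ψ - ψ'‖ ^ 2 = -(μ * ‖ψ - ψ'‖ ^ 2) := Complex.ofReal_injective (by
    push_cast
    exact h3)
  have h5 : μ * ‖ψ - ψ'‖ ^ 2 = 0 := by linarith
  rcases mul_eq_zero.1 h5 with h6 | h6
  · exact absurd h6 hμ.ne'
  · exact sub_eq_zero.1 (norm_eq_zero.1 (pow_eq_zero_iff two_ne_zero |>.1 h6))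

/-! ### The resolvent as a Laplace transform -/

theorem continuous_exp_smul_op (U : UnitaryGroup H) (μ : ℝ) (x : H) :
    Continuous fun t : ℝ => Real.exp (-μ * t) • U.op t x :=
  (by fun_prop : Continuous fun t : ℝ => Real.exp (-μ * t)).smul (U.continuous_op x)

theorem norm_exp_smul_op (U : UnitaryGroup H) (μ : ℝ) (x : H) (t : ℝ) :
    ‖Real.exp (-μ * t) • U.op t x‖ = Real.exp (-μ * t) * ‖x‖ := by
  rw [norm_smul, LinearIsometryEquiv.norm_map, Real.norm_of_nonneg (Real.exp_pos _).le]

theorem integrableOn_exp_smul_op (U : UnitaryGroup H) {μ : ℝ} (hμ : 0 < μ) (x : H) (a : ℝ) :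
    IntegrableOn (fun t : ℝ => Real.exp (-μ * t) • U.op t x) (Ioi a) := by
  refine Integrable.mono' ((integrableOn_exp_mul_Ioi (neg_lt_zero.2 hμ) a).mul_const ‖x‖)
    (U.continuous_exp_smul_op μ x).aestronglyMeasurable ?_
  exact Eventually.of_forall fun t => (U.norm_exp_smul_op μ x t).le

theorem norm_integral_exp_smul_op_le (U : UnitaryGroup H) {μ : ℝ} (hμ : 0 < μ) (x : H) :
    ‖∫ t in Ioi (0 : ℝ), Real.exp (-μ * t) • U.op t x‖ ≤ μ⁻¹ * ‖x‖ := by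
  refine (norm_integral_le_integral_norm _).trans_eq ?_
  simp only [norm_exp_smul_op]
  rw [integral_mul_const, integral_exp_mul_Ioi (neg_lt_zero.2 hμ)]
  simp [neg_div]

/-- The resolvent `(μ - A)⁻¹` of the generator `A` of the group. -/
noncomputable def resolvent (U : UnitaryGroup H) {μ : ℝ} (hμ : 0 < μ) : H →L[ℂ] H :=
  LinearMap.mkContinuous
    { toFun := fun x => ∫ t in Ioi (0 : ℝ), Real.exp (-μ * t) • U.op t x
      map_add' := fun x y => by
        rw [← integral_add (U.integrableOn_exp_smul_op hμ x 0) (U.integrableOn_exp_smul_op hμ y 0)]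
        simp only [map_add, smul_add]
      map_smul' := fun c x => by
        rw [RingHom.id_apply, ← integral_smul]
        simp only [map_smul, smul_comm c] }
    μ⁻¹ (U.norm_integral_exp_smul_op_le hμ)

theorem resolvent_apply (U : UnitaryGroup H) {μ : ℝ} (hμ : 0 < μ) (x : H) :
    U.resolvent hμ x = ∫ t in Ioi (0 : ℝ), Real.exp (-μ * t) • U.op t x := rfl

theorem norm_resolvent_apply_le (U : UnitaryGroup H) {μ : ℝ} (hμ : 0 < μ) (x : H) :
    ‖U.resolvent hμ x‖ ≤ μ⁻¹ * ‖x‖ :=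
  U.norm_integral_exp_smul_op_le hμ x

/-- Substituting `t + h` for `t` moves `h` out of the orbit and into the limit of integration. The
right side is then differentiable in `h` for every `x`, even when the orbit of `x` is only
continuous. -/
theorem op_resolvent [CompleteSpace H] (U : UnitaryGroup H) {μ : ℝ} (hμ : 0 < μ) (x : H) (h : ℝ) :
    U.op h (U.resolvent hμ x) = Real.exp (μ * h) •
      (U.resolvent hμ x - ∫ t in (0 : ℝ)..h, Real.exp (-μ * t) • U.op t x) := by
  have h1 : U.op h (U.resolvent hμ x) =
      ∫ t in Ioi (0 : ℝ), U.op h (Real.exp (-μ * t) • U.op t x) :=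
    ((U.op h).toContinuousLinearEquiv.toContinuousLinearMap.integral_comp_comm
      (U.integrableOn_exp_smul_op hμ x 0)).symm
  have h2 : ∀ t : ℝ, U.op h (Real.exp (-μ * t) • U.op t x) =
      Real.exp (μ * h) • (Real.exp (-μ * (t + h)) • U.op (t + h) x) := by
    intro t
    have e1 : U.op h (Real.exp (-μ * t) • U.op t x) = Real.exp (-μ * t) • U.op h (U.op t x) :=
      map_real_smul (U.op h) (U.op h).continuous _ _
    rw [e1, add_comm t h, U.op_add, smul_smul, ← Real.exp_add]
    congr 2
    ring
  have h3 : (∫ t in Ioi (0 : ℝ), Real.exp (-μ * (t + h)) • U.op (t + h) x) =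
      ∫ t in Ioi h, Real.exp (-μ * t) • U.op t x := by
    have := (measurePreserving_add_right volume h).setIntegral_preimage_emb
      (measurableEmbedding_addRight h) (fun t => Real.exp (-μ * t) • U.op t x) (Ioi h)
    simpa using this
  rw [h1]
  simp only [h2]
  rw [integral_smul, h3, resolvent_apply, eq_comm, sub_eq_iff_eq_add'.2]
  exact (intervalIntegral.integral_interval_add_Ioi (U.integrableOn_exp_smul_op hμ x 0)
    (U.integrableOn_exp_smul_op hμ x h)).symm

theorem generates_resolvent [CompleteSpace H] (U : UnitaryGroup H) {μ : ℝ} (hμ : 0 < μ) (x : H) :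
    U.Generates (U.resolvent hμ x) ((μ : ℂ) • U.resolvent hμ x - x) := by
  have hc := U.continuous_exp_smul_op μ x
  have h1 : HasDerivAt (fun h : ℝ => ∫ t in (0 : ℝ)..h, Real.exp (-μ * t) • U.op t x)
      (Real.exp (-μ * 0) • U.op 0 x) 0 :=
    intervalIntegral.integral_hasDerivAt_right (hc.intervalIntegrable _ _)
      (hc.stronglyMeasurableAtFilter _ _) hc.continuousAt
  have h2 : HasDerivAt (fun h : ℝ => Real.exp (μ * h)) (Real.exp (μ * 0) * (μ * 1)) 0 :=
    ((hasDerivAt_id (0 : ℝ)).const_mul μ).exp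
  have h3 := h2.fun_smul (h1.const_sub (U.resolvent hμ x))
  simp only [mul_zero, Real.exp_zero, one_smul, op_zero, mul_one, one_mul,
    intervalIntegral.integral_same, sub_zero] at h3
  simp only [Generates, op_resolvent]
  convert h3 using 1
  rw [Complex.coe_smul]
  abel

/-! ### The Hamiltonian -/

/-- The Hamiltonian `iħ A`, where `A` is the generator of the group. -/
noncomputable def hamiltonian (U : UnitaryGroup H) (hbar : ℝ) : H →ₗ.[ℂ] H where
  domain :=
    { carrier := {ψ | ∃ φ, U.Generates ψ φ}
      zero_mem' := ⟨0, U.generates_zero⟩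
      add_mem' := fun ⟨φ, h⟩ ⟨φ', h'⟩ => ⟨φ + φ', h.add h'⟩
      smul_mem' := fun c _ ⟨φ, h⟩ => ⟨c • φ, h.smul c⟩ }
  toFun :=
    { toFun := fun ψ => (Complex.I * (hbar : ℂ)) • ψ.2.choose
      map_add' := fun ψ ψ' => by
        rw [← smul_add,
          (ψ + ψ').2.choose_spec.unique (ψ.2.choose_spec.add ψ'.2.choose_spec)]
      map_smul' := fun c ψ => by
        rw [(c • ψ).2.choose_spec.unique (ψ.2.choose_spec.smul c), smul_comm, RingHom.id_apply] }

theorem mem_hamiltonian_domain {hbar : ℝ} : ψ ∈ (U.hamiltonian hbar).domain ↔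
    ∃ φ, U.Generates ψ φ := Iff.rfl

theorem Generates.hamiltonian_apply {hbar : ℝ} (h : U.Generates ψ φ)
    (hψ : ψ ∈ (U.hamiltonian hbar).domain) :
    U.hamiltonian hbar ⟨ψ, hψ⟩ = (Complex.I * (hbar : ℂ)) • φ := by
  change (Complex.I * (hbar : ℂ)) • hψ.choose = _
  rw [hψ.choose_spec.unique h]

theorem isFormalAdjoint_hamiltonian (U : UnitaryGroup H) (hbar : ℝ) :
    (U.hamiltonian hbar).IsFormalAdjoint (U.hamiltonian hbar) := by
  rintro ⟨ψ, hψ⟩ ⟨ψ', hψ'⟩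
  obtain ⟨φ, h⟩ := mem_hamiltonian_domain.1 hψ
  obtain ⟨φ', h'⟩ := mem_hamiltonian_domain.1 hψ'
  rw [h.hamiltonian_apply, h'.hamiltonian_apply, inner_smul_left, inner_smul_right, h.skew h']
  simp

theorem schrodinger (U : UnitaryGroup H) (hbar : ℝ) (hψ : ψ ∈ (U.hamiltonian hbar).domain)
    (t : ℝ) : ∃ (h : U.op t ψ ∈ (U.hamiltonian hbar).domain) (ψ' : H),
      HasDerivAt (fun s : ℝ => U.op s ψ) ψ' t ∧
        (Complex.I * (hbar : ℂ)) • ψ' = U.hamiltonian hbar ⟨U.op t ψ, h⟩ := by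
  obtain ⟨φ, h⟩ := hψ
  exact ⟨⟨_, h.op t⟩, U.op t φ, h.hasDerivAt t, ((h.op t).hamiltonian_apply _).symm⟩

/-! ### Resolvent identities and strong limits. -/

section Complete

variable [CompleteSpace H]

theorem Generates.resolvent_eq {μ : ℝ} (hμ : 0 < μ) (h : U.Generates ψ φ) :
    U.resolvent hμ ((μ : ℂ) • ψ - φ) = ψ :=
  (U.generates_resolvent hμ _).resolvent_unique hμ h (by abel)

theorem resolvent_op {μ : ℝ} (hμ : 0 < μ) (t : ℝ) (x : H) :
    U.resolvent hμ (U.op t x) = U.op t (U.resolvent hμ x) := by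
  have h := ((U.generates_resolvent hμ x).op t).resolvent_eq hμ
  have e : (μ : ℂ) • U.op t (U.resolvent hμ x) - U.op t ((μ : ℂ) • U.resolvent hμ x - x) =
      U.op t x := by
    rw [map_sub, map_smul, sub_sub_cancel]
  rwa [e] at h

/-- The reversed group has generator `-A`, so its resolvent is `(μ + A)⁻¹`. -/
theorem generates_reverse_resolvent (U : UnitaryGroup H) {μ : ℝ} (hμ : 0 < μ) (x : H) :
    U.Generates (U.reverse.resolvent hμ x) (x - (μ : ℂ) • U.reverse.resolvent hμ x) := by
  simpa [reverse_reverse] using (U.reverse.generates_resolvent hμ x).reverse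

/-- Skewness of `A`, applied to the two resolvent vectors; the terms in `μ` cancel. -/
theorem inner_resolvent (U : UnitaryGroup H) {μ : ℝ} (hμ : 0 < μ) (x y : H) :
    ⟪U.resolvent hμ x, y⟫_ℂ = ⟪x, U.reverse.resolvent hμ y⟫_ℂ := by
  have h := (U.generates_resolvent hμ x).skew (U.generates_reverse_resolvent hμ y)
  rw [inner_sub_left, inner_sub_right, inner_smul_left, inner_smul_right, Complex.conj_ofReal] at h
  linear_combination h

theorem resolvent_injective (U : UnitaryGroup H) {μ : ℝ} (hμ : 0 < μ) {x : H}
    (hx : U.resolvent hμ x = 0) : x = 0 := by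
  have h := U.generates_resolvent hμ x
  rw [hx] at h
  simpa using h.unique U.generates_zero

/-- On the domain, `μR_μ ψ - ψ = R_μ Aψ` has norm at most `‖Aψ‖/μ`. Since `‖μR_μ‖ ≤ 1`, convergence
extends from a dense set to all vectors. -/
theorem tendsto_smul_resolvent (U : UnitaryGroup H) {D : Set H} (hD : Dense D)
    (hgen : ∀ ψ ∈ D, ∃ φ, U.Generates ψ φ) {μ : ℕ → ℝ} (hμ : ∀ n, 0 < μ n)
    (hlim : Tendsto μ atTop atTop) (x : H) :
    Tendsto (fun n => (μ n : ℂ) • U.resolvent (hμ n) x) atTop (𝓝 x) := by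
  have hdiff : ∀ n y, ‖(μ n : ℂ) • U.resolvent (hμ n) y‖ ≤ ‖y‖ := fun n y => by
    rw [norm_smul, Complex.norm_real, Real.norm_of_nonneg (hμ n).le]
    calc μ n * ‖U.resolvent (hμ n) y‖ ≤ μ n * ((μ n)⁻¹ * ‖y‖) :=
          mul_le_mul_of_nonneg_left (U.norm_resolvent_apply_le (hμ n) y) (hμ n).le
      _ = ‖y‖ := by rw [← mul_assoc, mul_inv_cancel₀ (hμ n).ne', one_mul]
  rw [Metric.tendsto_atTop]
  intro ε hε
  obtain ⟨ψ, hψD, hψ⟩ := hD.exists_dist_lt x (show 0 < ε / 3 by positivity)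
  rw [dist_eq_norm] at hψ
  obtain ⟨φ, hφ⟩ := hgen ψ hψD
  have hψlim : Tendsto (fun n => (μ n)⁻¹ * ‖φ‖) atTop (𝓝 0) := by
    simpa using (tendsto_inv_atTop_zero.comp hlim).mul_const ‖φ‖
  obtain ⟨N, hN⟩ := eventually_atTop.1 (hψlim.eventually_lt_const (show 0 < ε / 3 by positivity))
  refine ⟨N, fun n hn => ?_⟩
  have h1 : (μ n : ℂ) • U.resolvent (hμ n) ψ - ψ = U.resolvent (hμ n) φ := by
    have h := hφ.resolvent_eq (hμ n)
    rw [map_sub, map_smul] at h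
    rw [sub_eq_iff_eq_add, add_comm, ← sub_eq_iff_eq_add]
    exact h
  have h2 : (μ n : ℂ) • U.resolvent (hμ n) x - x =
      (μ n : ℂ) • U.resolvent (hμ n) (x - ψ) + U.resolvent (hμ n) φ - (x - ψ) := by
    rw [← h1, map_sub, smul_sub]
    abel
  rw [dist_eq_norm, h2]
  have h3 := hdiff n (x - ψ)
  have h4 := (U.norm_resolvent_apply_le (hμ n) φ).trans_lt (hN n hn)
  have h5 := norm_sub_le ((μ n : ℂ) • U.resolvent (hμ n) (x - ψ) + U.resolvent (hμ n) φ) (x - ψ)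
  have h6 := norm_add_le ((μ n : ℂ) • U.resolvent (hμ n) (x - ψ)) (U.resolvent (hμ n) φ)
  linarith

/-! ### Bounded approximations of the generator -/

/-- The bounded approximation `μ² A (μ² - A²)⁻¹` of the generator `A`. -/
noncomputable def boundedGenerator (U : UnitaryGroup H) {μ : ℝ} (hμ : 0 < μ) : H →L[ℂ] H :=
  -- Partial fractions: `(μ - A)⁻¹ - (μ + A)⁻¹ = 2A(μ² - A²)⁻¹`.
  ((μ : ℂ) ^ 2 / 2) • (U.resolvent hμ - U.reverse.resolvent hμ)

theorem boundedGenerator_op {μ : ℝ} (hμ : 0 < μ) (t : ℝ) (x : H) :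
    U.boundedGenerator hμ (U.op t x) = U.op t (U.boundedGenerator hμ x) := by
  have h : U.reverse.resolvent hμ (U.op t x) = U.op t (U.reverse.resolvent hμ x) := by
    simpa [UnitaryGroup.reverse] using U.reverse.resolvent_op hμ (-t) x
  simp only [boundedGenerator, smul_apply, sub_apply,
    map_smul, map_sub, resolvent_op, h]

theorem boundedGenerator_mem_skewAdjoint (U : UnitaryGroup H) {μ : ℝ} (hμ : 0 < μ) :
    U.boundedGenerator hμ ∈ skewAdjoint (H →L[ℂ] H) := by
  have h1 : star (U.resolvent hμ) = U.reverse.resolvent hμ := by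
    rw [ContinuousLinearMap.star_eq_adjoint, eq_comm, ContinuousLinearMap.eq_adjoint_iff]
    intro x y
    rw [U.reverse.inner_resolvent, reverse_reverse]
  have h2 : star ((μ : ℂ) ^ 2 / 2) = (μ : ℂ) ^ 2 / 2 := by simp
  rw [skewAdjoint.mem_iff, boundedGenerator, star_smul, star_sub, ← h1, star_star, h2, ← smul_neg,
    neg_sub]

theorem norm_exp_boundedGenerator (U : UnitaryGroup H) {μ : ℝ} (hμ : 0 < μ) (t : ℝ) (x : H) :
    ‖NormedSpace.exp (t • U.boundedGenerator hμ) x‖ = ‖x‖ := by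
  have h : star (t • U.boundedGenerator hμ) = -(t • U.boundedGenerator hμ) := by
    have h1 := skewAdjoint.mem_iff.1 (U.boundedGenerator_mem_skewAdjoint hμ)
    rw [← Complex.coe_smul, star_smul, h1, smul_neg, Complex.star_def, Complex.conj_ofReal]
  have h2 : NormedSpace.exp (t • U.boundedGenerator hμ) ∈ unitary (H →L[ℂ] H) :=
    exp_mem_unitary_of_star_eq_neg (A := H →L[ℂ] H) h
  generalize NormedSpace.exp (t • U.boundedGenerator hμ) = D at h2 ⊢
  exact ContinuousLinearMap.norm_map_of_mem_unitary h2 x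

/-- Moving `A` through the resolvents leaves an average of two terms that both tend to `φ`. -/
theorem Generates.boundedGenerator_apply {μ : ℝ} (hμ : 0 < μ) (h : U.Generates ψ φ) :
    U.boundedGenerator hμ ψ =
      (1 / 2 : ℂ) • ((μ : ℂ) • U.resolvent hμ φ + (μ : ℂ) • U.reverse.resolvent hμ φ) := by
  have h1 := h.resolvent_eq hμ
  have h2 := h.reverse.resolvent_eq hμ
  rw [map_sub, map_smul] at h1 h2
  rw [map_neg, sub_neg_eq_add] at h2
  rw [sub_eq_iff_eq_add] at h1
  rw [← eq_sub_iff_add_eq] at h2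
  have h3 : (μ : ℂ) • (U.resolvent hμ ψ - U.reverse.resolvent hμ ψ) =
      U.resolvent hμ φ + U.reverse.resolvent hμ φ := by
    rw [smul_sub, h1, h2]; abel
  rw [← smul_add, ← h3, boundedGenerator, smul_apply,
    sub_apply, smul_smul, smul_smul]
  congr 1
  ring

/-- Duhamel: `s ↦ exp((t - s)B) U_s ψ` joins `exp(tB)ψ` at `s = 0` to `U_t ψ` at `s = t`. As `B`
commutes with `U_s`, its derivative is an isometric image of `φ - Bψ`, and the mean value inequality
applies. -/
theorem Generates.norm_exp_boundedGenerator_sub_le {μ : ℝ} (hμ : 0 < μ) (h : U.Generates ψ φ)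
    (t : ℝ) : ‖NormedSpace.exp (t • U.boundedGenerator hμ) ψ - U.op t ψ‖ ≤
      ‖U.boundedGenerator hμ ψ - φ‖ * |t| := by
  set B := U.boundedGenerator hμ with hB
  have hd : ∀ s : ℝ, HasDerivAt (fun s : ℝ => NormedSpace.exp ((t - s) • B) (U.op s ψ))
      (NormedSpace.exp ((t - s) • B) (U.op s (φ - B ψ))) s := by
    intro s
    have e1 : HasDerivAt (fun s : ℝ => NormedSpace.exp ((t - s) • B))
        (-(NormedSpace.exp ((t - s) • B) * B)) s := by
      have := (hasDerivAt_exp_smul_const (𝕂 := ℝ) B (t - s)).scomp s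
        ((hasDerivAt_id s).const_sub t)
      simpa using! this
    have e2 := HasDerivAt.clm_apply
      (c := fun s : ℝ => (NormedSpace.exp ((t - s) • B)).restrictScalars ℝ)
      (c' := (-(NormedSpace.exp ((t - s) • B) * B)).restrictScalars ℝ)
      ((ContinuousLinearMap.restrictScalarsL ℂ H H ℝ ℝ).hasFDerivAt.comp_hasDerivAt s e1)
      (h.hasDerivAt s)
    refine HasDerivAt.congr_deriv (f' := _) e2 ?_
    change -(NormedSpace.exp ((t - s) • B) (B (U.op s ψ))) +
      NormedSpace.exp ((t - s) • B) (U.op s φ) = _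
    rw [hB, boundedGenerator_op, map_sub, map_sub]
    abel
  have h1 := convex_univ.norm_image_sub_le_of_norm_hasDerivWithin_le
    (f := fun s : ℝ => NormedSpace.exp ((t - s) • B) (U.op s ψ)) (C := ‖φ - B ψ‖)
    (fun s _ => (hd s).hasDerivWithinAt)
    (fun s _ => by rw [hB, norm_exp_boundedGenerator, LinearIsometryEquiv.norm_map])
    (mem_univ t) (mem_univ 0)
  simp only [sub_zero, sub_self, zero_smul, NormedSpace.exp_zero, op_zero, zero_sub, norm_neg,
    Real.norm_eq_abs, one_apply_eq_self] at h1
  rwa [norm_sub_rev φ] at h1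

theorem tendsto_exp_boundedGenerator (U : UnitaryGroup H) {D : Set H} (hD : Dense D)
    (hgen : ∀ ψ ∈ D, ∃ φ, U.Generates ψ φ) {μ : ℕ → ℝ} (hμ : ∀ n, 0 < μ n)
    (hlim : Tendsto μ atTop atTop) (t : ℝ) (x : H) :
    Tendsto (fun n => NormedSpace.exp (t • U.boundedGenerator (hμ n)) x) atTop
      (𝓝 (U.op t x)) := by
  rw [Metric.tendsto_atTop]
  intro ε hε
  obtain ⟨ψ, hψD, hψ⟩ := hD.exists_dist_lt x (show 0 < ε / 3 by positivity)
  rw [dist_eq_norm] at hψ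
  obtain ⟨φ, hφ⟩ := hgen ψ hψD
  have hB : Tendsto (fun n => U.boundedGenerator (hμ n) ψ) atTop (𝓝 φ) := by
    have h1 := U.tendsto_smul_resolvent hD hgen hμ hlim φ
    have h2 := U.reverse.tendsto_smul_resolvent hD
      (fun ψ hψ => (hgen ψ hψ).imp' _ fun _ => Generates.reverse) hμ hlim φ
    have h3 := (h1.add h2).const_smul (1 / 2 : ℂ)
    rw [← two_smul ℂ φ, smul_smul, one_div, inv_mul_cancel₀ two_ne_zero, one_smul] at h3
    simpa only [hφ.boundedGenerator_apply, one_div] using h3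
  have hψlim : Tendsto (fun n => ‖U.boundedGenerator (hμ n) ψ - φ‖ * |t|) atTop (𝓝 0) := by
    simpa using (hB.sub_const φ).norm.mul_const |t|
  obtain ⟨N, hN⟩ := eventually_atTop.1 (hψlim.eventually_lt_const (show 0 < ε / 3 by positivity))
  refine ⟨N, fun n hn => ?_⟩
  set E := NormedSpace.exp (t • U.boundedGenerator (hμ n)) with hE
  have h1 : ‖E ψ - U.op t ψ‖ < ε / 3 := (hφ.norm_exp_boundedGenerator_sub_le (hμ n) t).trans_lt
    (hN n hn)
  have h2 : E x - U.op t x = E (x - ψ) + (E ψ - U.op t ψ) - U.op t (x - ψ) := by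
    simp only [map_sub]
    abel
  have h3 : ‖E (x - ψ)‖ = ‖x - ψ‖ := U.norm_exp_boundedGenerator (hμ n) t _
  have h4 : ‖U.op t (x - ψ)‖ = ‖x - ψ‖ := LinearIsometryEquiv.norm_map _ _
  have h5 := norm_sub_le (E (x - ψ) + (E ψ - U.op t ψ)) (U.op t (x - ψ))
  have h6 := norm_add_le (E (x - ψ)) (E ψ - U.op t ψ)
  rw [dist_eq_norm, h2]
  linarith

/-! ### Self-adjointness and the exponential formula. -/

/-- A vector orthogonal to the domain is orthogonal to the range of a resolvent, hence is killed by
its adjoint, the reversed resolvent, which is injective. -/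
theorem dense_hamiltonian_domain (U : UnitaryGroup H) (hbar : ℝ) :
    Dense ((U.hamiltonian hbar).domain : Set H) := by
  rw [Submodule.dense_iff_topologicalClosure_eq_top, Submodule.topologicalClosure_eq_top_iff,
    Submodule.eq_bot_iff]
  intro y hy
  refine U.reverse.resolvent_injective one_pos (ext_inner_left ℂ fun x => ?_)
  rw [← U.inner_resolvent, inner_zero_right]
  exact (Submodule.mem_orthogonal _ _).1 hy _ ⟨_, U.generates_resolvent one_pos x⟩

/-- `iħA - ik = -iħ(k/ħ - A)`, and `-1/(iħ) = i/ħ`. -/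
theorem isResolvent_hamiltonian (U : UnitaryGroup H) {hbar k : ℝ} (hbar_pos : 0 < hbar)
    (hk : 0 < k) : TimeTranslation.IsResolvent (U.hamiltonian hbar) (Complex.I * k)
      ((Complex.I / hbar) • U.resolvent (div_pos hk hbar_pos)) := by
  have hb : (hbar : ℂ) ≠ 0 := Complex.ofReal_ne_zero.2 hbar_pos.ne'
  have hI := Complex.I_sq
  refine ⟨fun x => ?_, ?_⟩
  · have h := (U.generates_resolvent (div_pos hk hbar_pos) x).smul (Complex.I / hbar)
    refine ⟨⟨_, h⟩, ?_⟩
    refine (congrArg (· - _) (h.hamiltonian_apply _)).trans ?_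
    rw [smul_apply]
    match_scalars
    · field_simp; ring
    · field_simp; linear_combination -hI
  · rintro ⟨ψ, hψ⟩
    obtain ⟨φ, h⟩ := mem_hamiltonian_domain.1 hψ
    have h1 := h.resolvent_eq (div_pos hk hbar_pos)
    rw [h.hamiltonian_apply, smul_apply, ← map_smul]
    refine Eq.trans ?_ h1
    congr 1
    match_scalars
    · field_simp; linear_combination hI
    · field_simp; linear_combination -k * hI

/-- `iħA + ik = iħ(k/ħ + A)`, and `1/(iħ) = -i/ħ`. -/
theorem isResolvent_hamiltonian_neg (U : UnitaryGroup H) {hbar k : ℝ} (hbar_pos : 0 < hbar)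
    (hk : 0 < k) : TimeTranslation.IsResolvent (U.hamiltonian hbar) (-(Complex.I * k))
      (-(Complex.I / hbar) • U.reverse.resolvent (div_pos hk hbar_pos)) := by
  have hb : (hbar : ℂ) ≠ 0 := Complex.ofReal_ne_zero.2 hbar_pos.ne'
  have hI := Complex.I_sq
  refine ⟨fun x => ?_, ?_⟩
  · have h := (U.generates_reverse_resolvent (div_pos hk hbar_pos) x).smul (-(Complex.I / hbar))
    refine ⟨⟨_, h⟩, ?_⟩
    refine (congrArg (· - _) (h.hamiltonian_apply _)).trans ?_
    rw [smul_apply]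
    match_scalars
    · field_simp; linear_combination -hI
    · field_simp; ring
  · rintro ⟨ψ, hψ⟩
    obtain ⟨φ, h⟩ := mem_hamiltonian_domain.1 hψ
    have h1 := h.reverse.resolvent_eq (div_pos hk hbar_pos)
    rw [h.hamiltonian_apply, smul_apply, ← map_smul]
    refine Eq.trans ?_ h1
    congr 1
    match_scalars
    · field_simp; linear_combination -hI
    · field_simp; linear_combination -k * hI

theorem isSelfAdjoint_hamiltonian (U : UnitaryGroup H) {hbar : ℝ} (hbar_pos : 0 < hbar) :
    IsSelfAdjoint (U.hamiltonian hbar) := by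
  have hdense := U.dense_hamiltonian_domain hbar
  have hle := (U.isFormalAdjoint_hamiltonian hbar).le_adjoint hdense
  refine (LinearPMap.eq_of_le_of_domain_eq hle (le_antisymm hle.1 fun y hy => ?_)).symm
  set A := U.hamiltonian hbar
  obtain ⟨hR, -⟩ := U.isResolvent_hamiltonian hbar_pos one_pos
  obtain ⟨hR', -⟩ := U.isResolvent_hamiltonian_neg hbar_pos one_pos
  -- Surjectivity of `A - i` (here `A` is the Hamiltonian) yields `w` in the domain with `(A - i)w =
  -- (A* - i)y`.
  obtain ⟨hw, hweq⟩ := hR (A.adjoint ⟨y, hy⟩ - (Complex.I * (1 : ℝ)) • y)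
  generalize ((Complex.I / hbar) • U.resolvent (div_pos one_pos hbar_pos))
    (A.adjoint ⟨y, hy⟩ - (Complex.I * (1 : ℝ)) • y) = w at hw hweq
  suffices h : y = w by rw [h]; exact hw
  -- Every `x` has the form `(A + i)v`, and `y - w` is orthogonal to all such vectors.
  refine ext_inner_right ℂ fun x => ?_
  obtain ⟨hv, hveq⟩ := hR' x
  generalize ((-(Complex.I / hbar)) • U.reverse.resolvent (div_pos one_pos hbar_pos)) x = v
    at hv hveq
  have h1 := LinearPMap.adjoint_isFormalAdjoint hdense ⟨y, hy⟩ ⟨v, hv⟩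
  have h2 := U.isFormalAdjoint_hamiltonian hbar ⟨w, hw⟩ ⟨v, hv⟩
  have h3 := congrArg (fun z => ⟪z, v⟫_ℂ) hweq
  simp only [inner_sub_left, inner_smul_left, map_mul, Complex.conj_I, Complex.conj_ofReal] at h3
  rw [← hveq, inner_sub_right, inner_sub_right, inner_smul_right, inner_smul_right]
  change ⟪A.adjoint ⟨y, hy⟩, v⟫_ℂ = ⟪y, A ⟨v, hv⟩⟫_ℂ at h1
  change ⟪A ⟨w, hw⟩, v⟫_ℂ = ⟪w, A ⟨v, hv⟩⟫_ℂ at h2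
  linear_combination -h3 - h1 + h2

theorem isExp_hamiltonian (U : UnitaryGroup H) {hbar : ℝ} (hbar_pos : 0 < hbar) (t : ℝ) :
    TimeTranslation.IsExp (U.hamiltonian hbar) ((t : ℂ) / (Complex.I * (hbar : ℂ)))
      (U.op t : H →L[ℂ] H) := by
  have hpos : ∀ n : ℕ, (0 : ℝ) < n + 1 := fun n => n.cast_add_one_pos
  have hb : (hbar : ℂ) ≠ 0 := Complex.ofReal_ne_zero.2 hbar_pos.ne'
  refine ⟨_, _, fun n => by simpa using U.isResolvent_hamiltonian hbar_pos (hpos n),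
    fun n => by simpa using U.isResolvent_hamiltonian_neg hbar_pos (hpos n), fun ψ => ?_⟩
  -- Truncating `iħA` at level `k = n + 1` is approximating `A` at level `μ = k/ħ`.
  have hlim : Tendsto (fun n : ℕ => ((n : ℝ) + 1) / hbar) atTop atTop :=
    (tendsto_atTop_add_const_right _ _ tendsto_natCast_atTop_atTop).atTop_div_const hbar_pos
  have h := U.tendsto_exp_boundedGenerator (U.dense_hamiltonian_domain hbar) (fun _ h => h)
    (fun n => div_pos (hpos n) hbar_pos) hlim t ψ
  refine h.congr fun n => ?_
  congr 2
  rw [← Complex.coe_smul, boundedGenerator, TimeTranslation.truncation]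
  -- The opposite signs of the two resolvents turn the sum in `truncation` into the difference in
  -- `boundedGenerator`.
  match_scalars <;> field_simp

end Complete

end UnitaryGroup

/-! ### From translations of sections to a unitary group on `H`. -/

namespace TimeTranslation

variable {M : Type*} [TopologicalSpace M]
  [ChartedSpace (EuclideanSpace ℝ (Fin 4)) M] [IsManifold (𝓡 4) ∞ M]
  {U : Spacetime M} {S : Type*} [TopologicalSpace S]
  [ChartedSpace (EuclideanSpace ℝ (Fin 3)) S] [IsManifold (𝓡 3) ∞ S]
  {S₀ : SpacelikeHypersurface U S}
  {V : Type*} [NormedAddCommGroup V] [NormedSpace ℂ V]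
  {F : M → Type*} [TopologicalSpace (TotalSpace V F)]
  [∀ m, AddCommGroup (F m)] [∀ m, Module ℂ (F m)]
  [∀ m, TopologicalSpace (F m)]

theorem reading_eq_reading_zero (G : GaussianChart S₀) (e : Trivialization V (π V F))
    [e.IsLinear ℂ] (he : G.region ⊆ e.baseSet) (θ : ℝ) (X : ∀ m : G.region, F m) (x : G.domain)
    (t : ℝ) : reading G e he θ X x t = reading G e he 0 X x (t - θ) := by
  have h : G.event θ x t = G.event 0 x (t - θ) := by simp [GaussianChart.event]
  exact congrArg (fun m : G.region => e.linearEquivAt ℂ (m : M) (he m.2) (X m)) h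

/-- Identities between translated sections can thus be checked on components, where a translation is
a shift of `t`. -/
theorem reading_zero_injective (G : GaussianChart S₀) (e : Trivialization V (π V F))
    [e.IsLinear ℂ] (he : G.region ⊆ e.baseSet) {X Y : ∀ m : G.region, F m}
    (h : ∀ x t, reading G e he 0 X x t = reading G e he 0 Y x t) : X = Y := by
  funext m
  have h1 := h (G.place m) (G.time m)
  have h2 := (e.linearEquivAt ℂ _ (he (G.event 0 (G.place m) (G.time m)).2)).injective h1
  rwa [G.event_place_time m] at h2

theorem translate_zero (G : GaussianChart S₀) (e : Trivialization V (π V F))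
    [e.IsLinear ℂ] (he : G.region ⊆ e.baseSet) (X : ∀ m : G.region, F m) :
    translate G e he 0 X = X :=
  reading_zero_injective G e he fun x t => reading_translate G e he 0 X x t

theorem translate_add (G : GaussianChart S₀) (e : Trivialization V (π V F))
    [e.IsLinear ℂ] (he : G.region ⊆ e.baseSet) (θ θ' : ℝ) (X : ∀ m : G.region, F m) :
    translate G e he (θ + θ') X = translate G e he θ (translate G e he θ' X) := by
  refine reading_zero_injective G e he fun x t => ?_
  rw [reading_translate, reading_translate, reading_eq_reading_zero,
    reading_eq_reading_zero G e he θ, reading_translate, reading_eq_reading_zero G e he θ', sub_sub]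

variable {G : GaussianChart S₀} {e : Trivialization V (π V F)} [e.IsLinear ℂ]
  {he : G.region ⊆ e.baseSet} {H : Type*} [NormedAddCommGroup H] [InnerProductSpace ℂ H]

/-- The translations of time, as linear automorphisms of the space of variables. -/
noncomputable def Model.translation (P : Model G e he H) (θ : ℝ) :
    P.sectionSpace ≃ₗ[ℂ] P.sectionSpace :=
  LinearEquiv.ofLinearMap
    ((translate G e he θ).restrict (P.translate_mem θ))
    ((translate G e he (-θ)).restrict (P.translate_mem (-θ)))
    (by
      ext1 X
      apply Subtype.ext
      change translate G e he θ (translate G e he (-θ) X) = X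
      rw [← translate_add, add_neg_cancel, translate_zero])
    (by
      ext1 X
      apply Subtype.ext
      change translate G e he (-θ) (translate G e he θ X) = X
      rw [← translate_add, neg_add_cancel, translate_zero])

theorem Model.translation_apply (P : Model G e he H) (θ : ℝ) (X : P.sectionSpace) :
    P.translation θ X = ⟨translate G e he θ X, P.translate_mem θ X X.2⟩ := rfl

theorem Model.translation_add (P : Model G e he H) (θ θ' : ℝ) (X : P.sectionSpace) :
    P.translation (θ + θ') X = P.translation θ (P.translation θ' X) :=
  Subtype.ext (translate_add G e he θ θ' X)

/-- On measured vectors both sides equal the inner product of the states, which does not depend on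
the observer; the rest follows from the span. -/
theorem Model.inner_translation (P : Model G e he H) (θ : ℝ) (X Y : P.sectionSpace) :
    ⟪P.linearChart (P.translation θ X), P.linearChart (P.translation θ Y)⟫_ℂ =
      ⟪P.linearChart X, P.linearChart Y⟫_ℂ := by
  have hX : X ∈ Submodule.span ℂ (Set.range (P.measure 0)) := P.measure_span ▸ Submodule.mem_top
  have hY : Y ∈ Submodule.span ℂ (Set.range (P.measure 0)) := P.measure_span ▸ Submodule.mem_top
  have hm : ∀ ψ, P.translation θ (P.measure 0 ψ) = P.measure θ ψ := fun ψ =>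
    Subtype.ext (P.measure_gauge θ ψ).symm
  induction hX, hY using Submodule.span_induction₂ with
  | mem_mem X Y hX hY =>
    obtain ⟨ψ₁, rfl⟩ := hX
    obtain ⟨ψ₂, rfl⟩ := hY
    rw [hm, hm, P.measure_kernel, P.measure_kernel]
  | zero_left Y hY => simp
  | zero_right X hX => simp
  | add_left X X' Y _ _ _ h h' => simp only [map_add, inner_add_left, h, h']
  | add_right X Y Y' _ _ _ h h' => simp only [map_add, inner_add_right, h, h']
  | smul_left c X Y _ _ h => simp only [map_smul, inner_smul_left, h]
  | smul_right c X Y _ _ h => simp only [map_smul, inner_smul_right, h]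

theorem Model.norm_translation (P : Model G e he H) (θ : ℝ) (X : P.sectionSpace) :
    ‖P.linearChart (P.translation θ X)‖ = ‖P.linearChart X‖ := by
  simp only [norm_eq_sqrt_re_inner (𝕜 := ℂ), P.inner_translation]

variable [CompleteSpace H]

/-- The unitary operator induced on the Hilbert space by a translation of time. -/
noncomputable def Model.unitary (P : Model G e he H) (θ : ℝ) : H ≃ₗᵢ[ℂ] H :=
  (P.translation θ).extendOfIsometry P.linearChart P.linearChart P.linearChart_dense
    P.linearChart_dense (P.norm_translation θ)

theorem Model.unitary_linearChart (P : Model G e he H) (θ : ℝ) (X : P.sectionSpace) :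
    P.unitary θ (P.linearChart X) = P.linearChart (P.translation θ X) :=
  LinearEquiv.extendOfIsometry_eq _ _ _ _ _ _ X

theorem Model.unitary_add (P : Model G e he H) (θ θ' : ℝ) (ψ : H) :
    P.unitary (θ + θ') ψ = P.unitary θ (P.unitary θ' ψ) := by
  refine P.linearChart_dense.induction_on ψ ?_ fun X => ?_
  · exact isClosed_eq (P.unitary _).continuous
      ((P.unitary _).continuous.comp (P.unitary _).continuous)
  · simp only [P.unitary_linearChart, P.translation_add]

/-- Isometry makes the approximation by the dense range uniform in `θ`. -/
theorem Model.tendsto_unitary_zero (P : Model G e he H) (ψ : H) :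
    Tendsto (fun θ : ℝ => P.unitary θ ψ) (𝓝 0) (𝓝 ψ) := by
  rw [Metric.tendsto_nhds]
  intro ε hε
  obtain ⟨X, hX⟩ := P.linearChart_dense.exists_dist_lt ψ (show 0 < ε / 3 by positivity)
  filter_upwards [Metric.tendsto_nhds.1 (P.translate_continuous X) (ε / 3) (by positivity)]
    with θ hθ
  have h1 : dist (P.unitary θ ψ) (P.linearChart (P.translation θ X)) < ε / 3 := by
    rwa [← P.unitary_linearChart, LinearIsometryEquiv.dist_map]
  have h2 := dist_triangle4_right (P.unitary θ ψ) ψ (P.linearChart (P.translation θ X))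
    (P.linearChart X)
  rw [← P.translation_apply] at hθ
  linarith

/-- The unitary group of the translations of time. -/
noncomputable def Model.unitaryGroup (P : Model G e he H) : UnitaryGroup H where
  op := P.unitary
  op_add := P.unitary_add
  continuous_op ψ := by
    rw [continuous_iff_continuousAt]
    intro t
    -- Continuity at `t` reduces to continuity at `0` through `U_s ψ = U_{s-t} U_t ψ`.
    have h1 : Tendsto (fun s : ℝ => s - t) (𝓝 t) (𝓝 0) := by
      simpa using (continuous_sub_right t).tendsto t
    have h2 := (P.tendsto_unitary_zero (P.unitary t ψ)).comp h1
    refine h2.congr fun s => ?_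
    rw [Function.comp_apply, ← P.unitary_add, sub_add_cancel]

end TimeTranslation

theorem proposition22
    (hbar : ℝ) (hbar_pos : 0 < hbar)
    {M : Type*} [TopologicalSpace M] [T2Space M]
    [ChartedSpace (EuclideanSpace ℝ (Fin 4)) M] [IsManifold (𝓡 4) ∞ M]
    {U : TimeTranslation.Spacetime M}
    {S : Type*} [TopologicalSpace S]
    [ChartedSpace (EuclideanSpace ℝ (Fin 3)) S] [IsManifold (𝓡 3) ∞ S]
    {S₀ : TimeTranslation.SpacelikeHypersurface U S}
    (G : TimeTranslation.GaussianChart S₀)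
    {V : Type*} [NormedAddCommGroup V] [NormedSpace ℂ V]
    {F : M → Type*} [TopologicalSpace (TotalSpace V F)]
    [∀ m, AddCommGroup (F m)] [∀ m, Module ℂ (F m)] [∀ m, TopologicalSpace (F m)]
    [FiberBundle V F] [VectorBundle ℂ V F]
    (e : Trivialization V (π V F)) [e.IsLinear ℂ] (he : G.region ⊆ e.baseSet)
    {H : Type*} [NormedAddCommGroup H] [InnerProductSpace ℂ H] [CompleteSpace H]
    (P : TimeTranslation.Model G e he H) :
    ∃ (Uhat : ℝ → H ≃ₗᵢ[ℂ] H) (Ham : H →ₗ.[ℂ] H),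
      (∀ (θ : ℝ) (X : P.sectionSpace), Uhat θ (P.linearChart X) =
        P.linearChart ⟨TimeTranslation.translate G e he θ X, P.translate_mem θ X X.2⟩) ∧
      Uhat 0 = LinearIsometryEquiv.refl ℂ H ∧
      (∀ (θ θ' : ℝ) (ψ : H), Uhat (θ + θ') ψ = Uhat θ (Uhat θ' ψ)) ∧
      (∀ ψ : H, Continuous fun θ : ℝ => Uhat θ ψ) ∧
      IsSelfAdjoint Ham ∧
      (∀ t : ℝ, TimeTranslation.IsExp Ham ((t : ℂ) / (Complex.I * (hbar : ℂ)))
        (Uhat t : H →L[ℂ] H)) ∧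
      (∀ (X : P.sectionSpace) (t : ℝ), P.evolution X t = Uhat t (P.evolution X 0)) ∧
      (∀ ψ₀ ∈ Ham.domain, ∀ t : ℝ, ∃ (h : Uhat t ψ₀ ∈ Ham.domain) (ψ' : H),
        HasDerivAt (fun s : ℝ => Uhat s ψ₀) ψ' t ∧
          (Complex.I * (hbar : ℂ)) • ψ' = Ham ⟨Uhat t ψ₀, h⟩)
  := by
  refine ⟨P.unitary, P.unitaryGroup.hamiltonian hbar, P.unitary_linearChart,
    LinearIsometryEquiv.ext P.unitaryGroup.op_zero, P.unitary_add, P.unitaryGroup.continuous_op,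
    P.unitaryGroup.isSelfAdjoint_hamiltonian hbar_pos,
    P.unitaryGroup.isExp_hamiltonian hbar_pos, fun X t => ?_,
    fun ψ₀ hψ₀ => P.unitaryGroup.schrodinger hbar hψ₀⟩
  -- The initial vector is the image of `U(0)X`, so the group law with `t + 0 = t` suffices.
  change P.linearChart (P.translation t X) = P.unitary t (P.linearChart (P.translation 0 X))
  rw [P.unitary_linearChart, ← P.translation_add, add_zero]
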